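/- Let $\mathcal{R}$ be the Riemann surface whose points are the homotopy classes (with fixed extremities) of paths $\gamma:[0,1]\to\mathbb{C}$ issuing from $0$ and lying inside $\mathbb{C}\setminus 2\pi\mathrm{i}\,\mathbb{Z}$ except for their initial point; the homotopies are through paths of the same kind, and the constant path at $0$ is also allowed, its class being the only point of $\mathcal{R}$ over $0$, called the origin of $\mathcal{R}$. Let $\pi:\mathcal{R}\to\mathbb{C}\setminus 2\pi\mathrm{i}\,\mathbb{Z}^*$, where $\mathbb{Z}^*=\mathbb{Z}\setminus\{0\}$, be the map sending the class of $\gamma$ to $\gamma(1)$; the complex structure of $\mathcal{R}$ is the pull-back by $\pi$ of that of $\mathbb{C}\setminus 2\pi\mathrm{i}\,\mathbb{Z}^*$. A germ $\hat\varphi$ of holomorphic function at the origin of $\mathbb{C}$ is said to extend holomorphically to $\mathcal{R}$ if there is a holomorphic function $\Phi$ on $\mathcal{R}$ such that $\Phi=\hat\varphi\circ\pi$ near the origin of $\mathcal{R}$. **Theorem.** Let $\hat\varphi$ and $\hat\psi$ be two germs of holomorphic functions at the origin of $\mathbb{C}$ which extend holomorphically to $\mathcal{R}$. Then their convolution product,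 i.e. the holomorphic germ at the origin defined for $|\zeta|$ small enough by $$(\hat\varphi*\hat\psi)(\zeta)=\int_0^{\zeta}\hat\varphi(\zeta_1)\,\hat\psi(\zeta-\zeta_1)\,\mathrm{d}\zeta_1$$ (integral along the segment $[0,\zeta]$), also extends holomorphically to $\mathcal{R}$. -/

import Mathlib

open scoped unitInterval

namespace Resurgence

/-- The set `2πiℤ ⊂ ℂ`. -/
def lattice : Set ℂ := {z | ∃ n : ℤ, z = 2 * Real.pi * Complex.I * n}

/-- A path issuing from the origin and lying inside `ℂ ∖ 2πiℤ` except for its initial point.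
The constant path at the origin is allowed: its class is the origin of `𝓡`. -/
def Admissible {ζ : ℂ} (γ : Path (0 : ℂ) ζ) : Prop :=
  (∀ t, γ t = 0) ∨ ∀ t : I, 0 < t → γ t ∉ lattice

/-- The admissible paths with extremity `ζ`. -/
def AdmPath (ζ : ℂ) : Type := {γ : Path (0 : ℂ) ζ // Admissible γ}

/-- Homotopy with fixed extremities within the class of admissible paths. -/
def AdmHomotopic {ζ : ℂ} (γ₀ γ₁ : AdmPath ζ) : Prop :=
  ∃ F : Path.Homotopy γ₀.1 γ₁.1, ∀ s, Admissible (F.eval s)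

theorem AdmHomotopic.refl {ζ : ℂ} (γ : AdmPath ζ) : AdmHomotopic γ γ :=
  ⟨Path.Homotopy.refl γ.1, fun _ => γ.2⟩

theorem AdmHomotopic.symm {ζ : ℂ} {γ₀ γ₁ : AdmPath ζ} (h : AdmHomotopic γ₀ γ₁) :
    AdmHomotopic γ₁ γ₀ := by
  obtain ⟨F, hF⟩ := h
  exact ⟨F.symm, fun s => hF (unitInterval.symm s)⟩

theorem AdmHomotopic.trans {ζ : ℂ} {γ₀ γ₁ γ₂ : AdmPath ζ} (h : AdmHomotopic γ₀ γ₁)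
    (h' : AdmHomotopic γ₁ γ₂) : AdmHomotopic γ₀ γ₂ := by
  obtain ⟨F, hF⟩ := h
  obtain ⟨G, hG⟩ := h'
  refine ⟨F.trans G, fun s => ?_⟩
  by_cases hs : (s : ℝ) ≤ 1 / 2
  · have : (F.trans G).eval s
        = F.eval ⟨2 * s, (unitInterval.mul_pos_mem_iff zero_lt_two).2 ⟨s.2.1, hs⟩⟩ := by
      ext t
      change (F.trans G) (s, t) = F (_, t)
      rw [Path.Homotopy.trans_apply, dif_pos hs]
    rw [this]
    exact hF _
  · have : (F.trans G).eval s = G.eval ⟨2 * s - 1,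
        unitInterval.two_mul_sub_one_mem_iff.2 ⟨(not_le.1 hs).le, s.2.2⟩⟩ := by
      ext t
      change (F.trans G) (s, t) = G (_, t)
      rw [Path.Homotopy.trans_apply, dif_neg hs]
    rw [this]
    exact hG _

instance admSetoid (ζ : ℂ) : Setoid (AdmPath ζ) where
  r := AdmHomotopic
  iseqv := ⟨AdmHomotopic.refl, AdmHomotopic.symm, AdmHomotopic.trans⟩

/-- The surface `𝓡`: a point is an extremity `ζ` together with a homotopy class of admissible
paths from `0` to `ζ`. The covering map `π : 𝓡 → ℂ ∖ 2πiℤ*` is the first projection. -/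
def RSurface : Type := Σ ζ : ℂ, Quotient (admSetoid ζ)

/-- The covering map `π`. -/
def RSurface.proj (c : RSurface) : ℂ := c.1

/-- The point of `𝓡` defined by an admissible path. -/
def RSurface.mk {ζ : ℂ} (γ : AdmPath ζ) : RSurface := ⟨ζ, Quotient.mk (admSetoid ζ) γ⟩

/-- The origin of `𝓡`: the class of the constant path. -/
noncomputable def RSurface.origin : RSurface := RSurface.mk ⟨Path.refl 0, Or.inl fun _ => rfl⟩

theorem Admissible.trans_segment {ζ w : ℂ} {γ : Path (0 : ℂ) ζ} (hγ : Admissible γ)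
    (h0 : ζ ≠ 0) (hw : ∀ t, Path.segment ζ w t ∉ lattice) :
    Admissible (γ.trans (Path.segment ζ w)) := by
  rcases hγ with hγ | hγ
  · exact absurd (by simpa using hγ 1) h0
  · refine Or.inr fun t ht => ?_
    rw [Path.trans_apply]
    split_ifs with h
    · exact hγ _ (Subtype.mk_lt_mk.2 (mul_pos two_pos ht))
    · exact hw _

/-- The admissible path `γ` followed by the segment `[ζ, w]`. -/
noncomputable def AdmPath.append {ζ w : ℂ} (h0 : ζ ≠ 0) (hw : ∀ t, Path.segment ζ w t ∉ lattice)
    (γ : AdmPath ζ) : AdmPath w :=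
  ⟨γ.1.trans (Path.segment ζ w), γ.2.trans_segment h0 hw⟩

theorem AdmPath.append_homotopic {ζ w : ℂ} (h0 : ζ ≠ 0)
    (hw : ∀ t, Path.segment ζ w t ∉ lattice) {γ₀ γ₁ : AdmPath ζ} (h : AdmHomotopic γ₀ γ₁) :
    AdmHomotopic (γ₀.append h0 hw) (γ₁.append h0 hw) := by
  obtain ⟨F, hF⟩ := h
  refine ⟨F.hcomp (Path.Homotopy.refl (Path.segment ζ w)), fun s => ?_⟩
  have : (F.hcomp (Path.Homotopy.refl (Path.segment ζ w))).eval s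
      = (F.eval s).trans (Path.segment ζ w) := by
    ext t
    change (F.hcomp (Path.Homotopy.refl (Path.segment ζ w))) (s, t) = _
    rw [Path.Homotopy.hcomp_apply, Path.trans_apply]
    rfl
  exact this ▸ (hF s).trans_segment h0 hw

open Classical in
/-- `c.move w` is the point of `𝓡` reached from `c` by following the lift of the segment
`[π c, w]`: from a point `c` other than the origin, append the segment to a representative of `c`;
from the origin, take the class of the segment `[0, w]` itself. If the segment meets `2πiℤ` (at a
point other than the starting point when this is `0`), the value is the irrelevant value `c`.
On a small disc around `π c` the segment never does so, and `w ↦ c.move w` is there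
the local inverse of `π` that maps `π c` to `c`. -/
noncomputable def RSurface.move (c : RSurface) (w : ℂ) : RSurface :=
  if h0 : c.1 = 0 then
    if hw : Admissible (Path.segment 0 w) then RSurface.mk ⟨Path.segment 0 w, hw⟩ else c
  else
    if hw : ∀ t, Path.segment c.1 w t ∉ lattice then
      ⟨w, Quotient.map (AdmPath.append h0 hw)
        (fun _ _ h => AdmPath.append_homotopic h0 hw h) c.2⟩
    else c

/-- Holomorphic functions on `𝓡`, for the complex structure pulled back by `π`: around every point
`c`, the function is holomorphic when read in the coordinate `w = π`, that is, through the local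
inverse `w ↦ c.move w` of `π`. -/
def HolomorphicOnR (Φ : RSurface → ℂ) : Prop :=
  ∀ c : RSurface, AnalyticAt ℂ (fun w => Φ (c.move w)) c.proj

/-- The germ of `φ` at the origin of `ℂ` extends holomorphically to `𝓡`: it is the germ at the
origin of a holomorphic function on `𝓡`, read in the coordinate `π`. -/
def ExtendsToR (φ : ℂ → ℂ) : Prop :=
  ∃ Φ : RSurface → ℂ, HolomorphicOnR Φ ∧
    ∀ᶠ w in nhds (0 : ℂ), Φ (RSurface.origin.move w) = φ w

/-- The convolution `∫₀^ζ φ(ζ₁) ψ(ζ - ζ₁) dζ₁`, along the segment `[0, ζ]` parametrised by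
`ζ₁ = t ζ`. For `φ`, `ψ` holomorphic near `0`, its germ at `0` is the convolution product of
the germs of `φ` and `ψ`. -/
noncomputable def convolution (φ ψ : ℂ → ℂ) (ζ : ℂ) : ℂ :=
  ∫ t in (0 : ℝ)..1, φ (t * ζ) * ψ (ζ - t * ζ) * ζ

end Resurgence

open scoped unitInterval

namespace Resurgence

/-! A germ extends to `𝓡` exactly when it continues analytically along every admissible path
(`ContAlong`). The two directions are `ExtendsToR.contAlong` and `ContAlong.extendsToR`, so the task
is to continue `φ * ψ` along an admissible path `γ`.

As `ζ = γ t` moves away from `0`, the segment `[0, ζ]` has to be deformed so that neither `ζ₁` nor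
`ζ - ζ₁` runs into a singularity. `exists_isSymmFamily` provides paths `H t` from `0` to `γ t`,
avoiding `2πiℤ` after their start, with `H t (1 - s) = γ t - H t s`. While `ζ₁` traverses `H t`, the
point `ζ - ζ₁` traverses the same path backwards, so both factors of the integrand continue along
it. These paths arise by dragging: when `ζ` is displaced, a point `x` receives the fraction `d(x) /
(d(x) + d(ζ - x))` of the displacement, `d` being the distance to `2πiℤ`. This fraction vanishes on
the lattice and turns into its complement under `x ↦ ζ - x`. Its denominator is at least `d(ζ)`,
because the lattice is stable under addition.

For each `t`, a primitive in `ζ₁` of the continued integrand, with `ζ` as a parameter, is continued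
along `H t` (`IsCont.exists_primitive`). Its final germ, restricted to the diagonal `ζ₁ = ζ`, is the
required germ at `γ t`. These germs fit together as `t` varies by `IsCont.monodromy`, which reduces
the question to the start `ζ₁ = 0`. -/

open Filter Topology Metric

/-! ### Analytic continuation along paths in a complex normed space. -/

section Continuation

variable {E : Type*} [NormedAddCommGroup E] [NormedSpace ℂ E]

/-- `f` is holomorphic on a neighbourhood of `x`. -/
def HolAt (f : E → ℂ) (x : E) : Prop := ∀ᶠ y in 𝓝 x, DifferentiableAt ℂ f y

theorem HolAt.congr {f g : E → ℂ} {x : E} (hf : HolAt f x) (h : g =ᶠ[𝓝 x] f) : HolAt g x := by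
  filter_upwards [hf, h.eventuallyEq_nhds] with y hy hy'
  exact (hy'.differentiableAt_iff (𝕜 := ℂ)).2 hy

theorem HolAt.eventually {f : E → ℂ} {x : E} (hf : HolAt f x) : ∀ᶠ y in 𝓝 x, HolAt f y :=
  hf.eventually_nhds

theorem HolAt.exists_ball {f : E → ℂ} {x : E} (hf : HolAt f x) :
    ∃ r > 0, DifferentiableOn ℂ f (ball x r) := by
  obtain ⟨r, hr, h⟩ := Metric.eventually_nhds_iff_ball.1 hf
  exact ⟨r, hr, fun y hy => (h y hy).differentiableWithinAt⟩

theorem holAt_of_differentiableOn {f : E → ℂ} {U : Set E} {x : E} (hf : DifferentiableOn ℂ f U)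
    (hU : IsOpen U) (hx : x ∈ U) : HolAt f x := by
  filter_upwards [hU.mem_nhds hx] with y hy using hf.differentiableAt (hU.mem_nhds hy)

theorem holAt_iff_analyticAt {f : ℂ → ℂ} {x : ℂ} : HolAt f x ↔ AnalyticAt ℂ f x :=
  Complex.analyticAt_iff_eventually_differentiableAt.symm

/-- Identity theorem on a ball. -/
theorem eqOn_ball_of_eventuallyEq {f g : E → ℂ} {x y : E} {r : ℝ}
    (hf : DifferentiableOn ℂ f (ball x r)) (hg : DifferentiableOn ℂ g (ball x r))
    (hy : y ∈ ball x r) (h : f =ᶠ[𝓝 y] g) : Set.EqOn f g (ball x r) := by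
  intro z hz
  -- On the complex line through `y` and `z`, the ball cuts out a convex, hence connected, set of
  -- parameters, so the one-variable identity theorem suffices.
  set l : ℂ → E := fun c => y + c • (z - y) with hl
  have hld : Differentiable ℂ l := by fun_prop
  set U : Set ℂ := l ⁻¹' ball x r with hU
  have hUo : IsOpen U := isOpen_ball.preimage hld.continuous
  have hUc : Convex ℝ U := by
    intro a ha b hb s t hs ht hst
    have := (convex_ball x r) ha hb hs ht hst
    have e : l (s • a + t • b) = s • l a + t • l b := by
      have : s • y + t • y = y := by rw [← add_smul, hst, one_smul]
      simp only [hl, smul_add, add_smul, smul_assoc]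
      nth_rewrite 1 [← this]
      abel
    change l (s • a + t • b) ∈ ball x r
    rw [e]; exact this
  have h0 : l 0 = y := by simp [hl]
  have h1 : l 1 = z := by simp [hl]
  have ana : ∀ k : E → ℂ, DifferentiableOn ℂ k (ball x r) → AnalyticOnNhd ℂ (k ∘ l) U :=
    fun k hk => (hk.comp hld.differentiableOn (fun _ hc => hc)).analyticOnNhd hUo
  have := (ana f hf).eqOn_of_preconnected_of_eventuallyEq (ana g hg) hUc.isPreconnected
    (z₀ := 0) (by simpa [hU, h0] using hy)
    (hld.continuous.tendsto' 0 y h0 |>.eventually h)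
  simpa [h1] using this (show (1 : ℂ) ∈ U by simpa [hU, h1] using hz)

/-- Equality of germs passes from nearby points back to `x`. This gives the closedness half of the
connectedness argument in `IsCont.unique`. -/
theorem HolAt.eventually_eventuallyEq {f g : E → ℂ} {x : E} (hf : HolAt f x) (hg : HolAt g x) :
    ∀ᶠ y in 𝓝 x, f =ᶠ[𝓝 y] g → f =ᶠ[𝓝 x] g := by
  obtain ⟨r, hr, h⟩ := Metric.eventually_nhds_iff_ball.1 (hf.and hg)
  filter_upwards [ball_mem_nhds x hr] with y hy he
  exact (eqOn_ball_of_eventuallyEq (fun y hy => (h y hy).1.differentiableWithinAt)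
    (fun y hy => (h y hy).2.differentiableWithinAt) hy he).eventuallyEq_of_mem (ball_mem_nhds x hr)

/-- `F` is an analytic continuation along the path `γ`: `F s` represents the germ at `γ s`. -/
def IsCont (γ : I → E) (F : I → E → ℂ) : Prop :=
  ∀ s, HolAt (F s) (γ s) ∧ ∀ᶠ s' in 𝓝 s, F s' =ᶠ[𝓝 (γ s')] F s

theorem isCont_const {γ : I → E} {f : E → ℂ} (h : ∀ s, HolAt f (γ s)) :
    IsCont γ (fun _ => f) :=
  fun s => ⟨h s, Eventually.of_forall fun _ => EventuallyEq.rfl⟩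

theorem IsCont.congr {γ : I → E} {F G : I → E → ℂ} (hγ : Continuous γ) (hF : IsCont γ F)
    (h : ∀ s, G s =ᶠ[𝓝 (γ s)] F s) : IsCont γ G := by
  refine fun s => ⟨(hF s).1.congr (h s), ?_⟩
  filter_upwards [(hF s).2, hγ.continuousAt.eventually (h s).eventuallyEq_nhds] with s' h1 h2
  exact ((h s').trans h1).trans h2.symm

/-- Uniqueness of analytic continuation along a path. -/
theorem IsCont.unique {γ : I → E} {F G : I → E → ℂ} (hγ : Continuous γ) (hF : IsCont γ F)
    (hG : IsCont γ G) {s₀ : I} (h : F s₀ =ᶠ[𝓝 (γ s₀)] G s₀) (s : I) :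
    F s =ᶠ[𝓝 (γ s)] G s := by
  have hclopen : IsClopen {s | F s =ᶠ[𝓝 (γ s)] G s} := by
    refine ⟨⟨isOpen_iff_eventually.2 fun s hs => ?_⟩, isOpen_iff_eventually.2 fun s hs => ?_⟩
    · filter_upwards [(hF s).2, (hG s).2, hγ.continuousAt.eventually
        ((hF s).1.eventually_eventuallyEq (hG s).1)] with s' h1 h2 h3 h4
      exact hs (h3 ((h1.symm.trans h4).trans h2))
    · filter_upwards [(hF s).2, (hG s).2, hγ.continuousAt.eventually
        (EventuallyEq.eventuallyEq_nhds hs)] with s' h1 h2 h3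
      exact (h1.trans h3).trans h2.symm
  have := hclopen.eq_univ ⟨s₀, h⟩
  exact (this ▸ Set.mem_univ s : s ∈ {s | F s =ᶠ[𝓝 (γ s)] G s})

/-- A continuation along a path is also one along all nearby paths. -/
theorem IsCont.exists_perturb {γ : I → E} {F : I → E → ℂ} (hγ : Continuous γ)
    (hF : IsCont γ F) : ∃ r > 0, ∃ G : I → E → ℂ, (∀ s, G s =ᶠ[𝓝 (γ s)] F s) ∧
      ∀ γ' : I → E, (∀ s, dist (γ' s) (γ s) < r) → IsCont γ' G := by
  -- The radius is doubled so that a ball of radius at most `ρ s` about any point of `ball (γ s) (ρ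
  -- s)` stays in the domain of `F s`.
  have hloc : ∀ s, ∃ ρ > 0, DifferentiableOn ℂ (F s) (ball (γ s) (2 * ρ)) ∧
      ∃ U : Set I, IsOpen U ∧ s ∈ U ∧
        ∀ s' ∈ U, γ s' ∈ ball (γ s) ρ ∧ F s' =ᶠ[𝓝 (γ s')] F s := by
    intro s
    obtain ⟨ρ, hρ, hd⟩ := (hF s).1.exists_ball
    refine ⟨ρ / 2, by positivity, by rwa [mul_div_cancel₀ _ two_ne_zero], ?_⟩
    obtain ⟨U, hU, hUo, hs⟩ := _root_.eventually_nhds_iff.1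
      ((hγ.continuousAt.eventually (ball_mem_nhds (γ s) (half_pos hρ))).and (hF s).2)
    exact ⟨U, hUo, hs, hU⟩
  choose ρ hρ hd U hUo hsU hU using hloc
  obtain ⟨T, hT⟩ := isCompact_univ.elim_finite_subcover U hUo
    (fun s _ => Set.mem_iUnion.2 ⟨s, hsU s⟩)
  have hTne : T.Nonempty := by
    obtain ⟨i, hi, -⟩ := Set.mem_iUnion₂.1 (hT (Set.mem_univ (0 : I)))
    exact ⟨i, hi⟩
  obtain ⟨i₀, -, hmin⟩ := T.exists_min_image ρ hTne
  obtain ⟨δ, hδ, hleb⟩ := lebesgue_number_lemma_of_metric (c := fun i : T => U i) isCompact_univ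
    (fun i => hUo i) (fun s hs => by
      obtain ⟨i, hi, h⟩ := Set.mem_iUnion₂.1 (hT hs)
      exact Set.mem_iUnion.2 ⟨⟨i, hi⟩, h⟩)
  choose j hj using fun s : I => hleb s (Set.mem_univ s)
  have hsub : ∀ s s', dist s' s < δ → DifferentiableOn ℂ (F (j s)) (ball (γ s') (ρ i₀)) := by
    intro s s' h
    refine (hd _).mono (ball_subset_ball' ?_)
    have h1 := (hU _ s' (hj s h)).1
    have h2 := hmin (j s) (j s).2
    rw [mem_ball] at h1
    linarith
  -- `G` takes only finitely many values, the representatives `F i` with `i ∈ T`, so the smallest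
  -- radius `ρ i₀` serves for all of them.
  refine ⟨ρ i₀, hρ _, fun s => F (j s), fun s => ?_, fun γ' hγ' s => ⟨?_, ?_⟩⟩
  · exact ((hU _ s (hj s (mem_ball_self hδ))).2).symm
  · exact holAt_of_differentiableOn (hsub s s (by simpa using hδ)) isOpen_ball (hγ' s)
  · filter_upwards [ball_mem_nhds s hδ] with s' hs'
    have h1 := (hU _ s' (hj s hs')).2
    have h2 := (hU _ s' (hj s' (mem_ball_self hδ))).2
    exact (eqOn_ball_of_eventuallyEq (hsub s' s' (by simpa using hδ)) (hsub s s' hs')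
      (mem_ball_self (hρ _)) (h2.symm.trans h1)).eventuallyEq_of_mem (isOpen_ball.mem_nhds (hγ' s'))

/-- Monodromy: in a continuous family of paths, if the initial germs of the continuations fit
together, so do the final germs. -/
theorem IsCont.monodromy {H : I → I → E} (hH : Continuous fun p : I × I => H p.1 p.2)
    {F : I → I → E → ℂ} (hF : ∀ t, IsCont (H t) (F t))
    (h0 : IsCont (fun t => H t 0) (fun t => F t 0)) (s : I) :
    IsCont (fun t => H t s) (fun t => F t s) := by
  refine fun t => ⟨(hF t s).1, ?_⟩
  have hHt : ∀ t, Continuous (H t) := fun t => hH.comp (by fun_prop : Continuous fun s : I => (t, s))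
  have hHs : ∀ s, Continuous fun t => H t s :=
    fun s => hH.comp (by fun_prop : Continuous fun t : I => (t, s))
  obtain ⟨r, hr, G, hG, hG'⟩ := (hF t).exists_perturb (hHt t)
  have hclose : ∀ᶠ t' in 𝓝 t, ∀ s, dist (H t' s) (H t s) < r := by
    have h1 : IsOpen {p : I × I | dist (H p.1 p.2) (H t p.2) < r} :=
      isOpen_lt (hH.dist ((hHt t).comp continuous_snd)) continuous_const
    obtain ⟨V, W, hV, hW, htV, hsW, hVW⟩ := generalized_tube_lemma (isCompact_singleton (x := t))
      (isCompact_univ (X := I)) h1 (by rintro ⟨a, b⟩ ⟨rfl, -⟩; simpa using hr)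
    filter_upwards [hV.mem_nhds (htV rfl)] with t' ht' s
    exact hVW (Set.mk_mem_prod ht' (hsW (Set.mem_univ s)))
  -- For `t'` near `t`, both `F t'` and `G` are continuations along `H t'`. They agree at parameter
  -- `0` by `h0`, hence at `s` by uniqueness.
  filter_upwards [hclose, (h0 t).2, (hHs 0).continuousAt.eventually (hG 0).eventuallyEq_nhds,
    (hHs s).continuousAt.eventually (hG s).eventuallyEq_nhds] with t' h1 h2 h3 h4
  exact ((hF t').unique (hHt t') (hG' _ h1) (s₀ := 0) (h2.trans h3.symm) s).trans h4

/-- A class of germs in which germs extend locally admits continuation along paths. -/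
theorem exists_isCont_of_local {p : I → E} (hp : Continuous p) (Q : I → (E → ℂ) → Prop)
    (hQ : ∀ s g, Q s g → HolAt g (p s))
    (hloc : ∀ s, ∃ U : Set I, IsOpen U ∧ s ∈ U ∧ ∀ a ∈ U, ∀ g, Q a g →
      ∃ g', g' =ᶠ[𝓝 (p a)] g ∧ ∀ b ∈ U, Q b g')
    {g₀ : E → ℂ} (h₀ : Q 0 g₀) : ∃ K : I → E → ℂ, K 0 = g₀ ∧ IsCont p K := by
  choose U hUo hsU hU using hloc
  obtain ⟨t, ht0, htm, ⟨N, hN⟩, ht⟩ := exists_monotone_Icc_subset_open_cover_unitInterval hUo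
    (fun s _ => Set.mem_iUnion.2 ⟨s, hsU s⟩)
  -- Induction along a subdivision: `K` is constrained only on `[0, t n]`, and compatibility of
  -- germs is required only relative to that interval.
  have key : ∀ n, ∃ K : I → E → ℂ, K 0 = g₀ ∧ ∀ s ≤ t n, Q s (K s) ∧
      ∀ᶠ s' in 𝓝 s, s' ≤ t n → K s' =ᶠ[𝓝 (p s')] K s := by
    intro n
    induction n with
    | zero =>
      refine ⟨fun _ => g₀, rfl, fun s hs => ⟨?_, Eventually.of_forall fun _ _ => EventuallyEq.rfl⟩⟩
      rw [ht0] at hs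
      rwa [le_antisymm hs s.2.1]
    | succ n ih =>
      obtain ⟨K, hK0, hK⟩ := ih
      obtain ⟨i, hi⟩ := ht n
      have hle : t n ≤ t (n + 1) := htm n.le_succ
      obtain ⟨g', hg', hg''⟩ := hU i (t n) (hi ⟨le_rfl, hle⟩) (K (t n)) (hK _ le_rfl).1
      refine ⟨fun s => if s ≤ t n then K s else g', ?_, fun s hs => ?_⟩
      · exact (if_pos (t n).2.1).trans hK0
      rcases lt_trichotomy s (t n) with h | h | h
      · refine ⟨by simpa [h.le] using (hK s h.le).1, ?_⟩
        filter_upwards [(hK s h.le).2, eventually_lt_nhds h] with s' h1 h2 _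
        simpa [h.le, h2.le] using h1 h2.le
      · subst h
        refine ⟨by simpa using (hK _ le_rfl).1, ?_⟩
        filter_upwards [(hK _ le_rfl).2, hp.continuousAt.eventually hg'.eventuallyEq_nhds]
          with s' h1 h2 _
        by_cases h3 : s' ≤ t n
        · simpa [h3] using h1 h3
        · simpa [h3] using h2
      · refine ⟨by simpa [not_le.2 h] using hg'' s (hi ⟨h.le, hs⟩), ?_⟩
        filter_upwards [eventually_gt_nhds h] with s' h1 _
        simp [not_le.2 h, not_le.2 h1]
  obtain ⟨K, hK0, hK⟩ := key N
  have hle : ∀ s : I, s ≤ t N := fun s => hN N le_rfl ▸ s.2.2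
  refine ⟨K, hK0, fun s => ⟨hQ _ _ (hK s (hle s)).1, ?_⟩⟩
  filter_upwards [(hK s (hle s)).2] with s' h using h (hle s')

end Continuation

/-! ### Primitives in the first of two variables, and their continuation. -/

section Primitive

theorem HolAt.comp {E E' : Type*} [NormedAddCommGroup E] [NormedSpace ℂ E] [NormedAddCommGroup E']
    [NormedSpace ℂ E'] {f : E → ℂ} {l : E' → E} {x : E'} (hf : HolAt f (l x))
    (hl : Differentiable ℂ l) : HolAt (fun y => f (l y)) x := by
  filter_upwards [hl.continuous.continuousAt.eventually hf] with y hy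
  exact hy.comp y (hl y)

theorem HolAt.add {E : Type*} [NormedAddCommGroup E] [NormedSpace ℂ E] {f g : E → ℂ} {x : E}
    (hf : HolAt f x) (hg : HolAt g x) : HolAt (fun y => f y + g y) x := by
  filter_upwards [hf, hg] with y h1 h2 using h1.fun_add h2

/-- The integral of `f (·, z.2)` along the segment from `a` to `z.1`. -/
noncomputable def segInt (f : ℂ × ℂ → ℂ) (a : ℂ) (z : ℂ × ℂ) : ℂ :=
  ∫ t in (0 : ℝ)..1, f (a + t * (z.1 - a), z.2) * (z.1 - a)

theorem segInt_self (f : ℂ × ℂ → ℂ) (a b : ℂ) : segInt f a (a, b) = 0 := by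
  simp [segInt]

theorem lineMap_mem_ball {c : ℂ × ℂ} {ρ : ℝ} {a : ℂ} (ha : a ∈ ball c.1 ρ) {z : ℂ × ℂ}
    (hz : z ∈ ball c ρ) {t : ℝ} (ht : t ∈ Set.Icc (0 : ℝ) 1) :
    (a + t * (z.1 - a), z.2) ∈ ball c ρ := by
  rw [← Prod.mk.eta (p := c), ← ball_prod_same] at hz ⊢
  refine ⟨?_, hz.2⟩
  have := (convex_ball c.1 ρ) ha hz.1 (sub_nonneg.2 ht.2) ht.1 (by ring)
  convert this using 1
  simp only [Complex.real_smul]; push_cast; ring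

/-- Differentiation under the integral sign, in the end point and the parameter jointly. The
derivative of the integrand is bounded by compactness of `closedBall z ε × [0, 1]`. -/
theorem differentiableAt_segInt {f : ℂ × ℂ → ℂ} {c : ℂ × ℂ} {ρ : ℝ}
    (hf : AnalyticOnNhd ℂ f (ball c ρ)) {a : ℂ} (ha : a ∈ ball c.1 ρ) {z : ℂ × ℂ}
    (hz : z ∈ ball c ρ) : DifferentiableAt ℂ (segInt f a) z := by
  have hsplit : segInt f a = fun z => (∫ t in (0 : ℝ)..1, f (a + t * (z.1 - a), z.2)) * (z.1 - a) := by
    ext z; simp only [segInt]; rw [intervalIntegral.integral_mul_const]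
  rw [hsplit]
  refine DifferentiableAt.mul ?_ (by fun_prop)
  obtain ⟨ε, hε, hεs⟩ := Metric.isOpen_ball.mem_nhds hz |> Metric.nhds_basis_closedBall.mem_iff.1
  set l : ℝ → ℂ × ℂ → ℂ × ℂ := fun t z => (a + t * (z.1 - a), z.2) with hl
  set L : ℝ → (ℂ × ℂ →L[ℂ] ℂ × ℂ) := fun t =>
    ((t : ℂ) • ContinuousLinearMap.fst ℂ ℂ ℂ).prod (ContinuousLinearMap.snd ℂ ℂ ℂ) with hL
  have hLc : Continuous L := by
    have : L = fun t : ℝ => (t : ℂ) • ((ContinuousLinearMap.fst ℂ ℂ ℂ).prod 0) +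
        ContinuousLinearMap.prod 0 (ContinuousLinearMap.snd ℂ ℂ ℂ) := by
      ext t <;> simp [hL]
    rw [this]; fun_prop
  have hlL : ∀ t z, HasFDerivAt (l t) (L t) z := by
    intro t z
    refine HasFDerivAt.prodMk ?_ hasFDerivAt_snd
    exact ((hasFDerivAt_fst.sub_const a).const_mul (t : ℂ)).const_add a
  have hlc : Continuous fun q : (ℂ × ℂ) × ℝ => l q.2 q.1 := by fun_prop
  have hmem : ∀ w ∈ closedBall z ε, ∀ t ∈ Set.Icc (0 : ℝ) 1, l t w ∈ ball c ρ :=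
    fun w hw t ht => lineMap_mem_ball ha (hεs hw) ht
  have hfd : ContinuousOn (fderiv ℂ f) (ball c ρ) := hf.fderiv.continuousOn
  have hcont : ∀ w ∈ closedBall z ε, ContinuousOn (fun t => f (l t w)) (Set.uIcc 0 1) := by
    intro w hw
    rw [Set.uIcc_of_le zero_le_one]
    exact hf.continuousOn.comp (hlc.comp (by fun_prop : Continuous fun t : ℝ => (w, t))).continuousOn
      (hmem w hw)
  have hF'c : ContinuousOn (fun q : (ℂ × ℂ) × ℝ => (fderiv ℂ f (l q.2 q.1)).comp (L q.2))
      (closedBall z ε ×ˢ Set.Icc 0 1) :=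
    (hfd.comp hlc.continuousOn fun q hq => hmem _ hq.1 _ hq.2).clm_comp
      (hLc.comp continuous_snd).continuousOn
  obtain ⟨C, hC⟩ := ((isCompact_closedBall z ε).prod isCompact_Icc).exists_bound_of_continuousOn hF'c
  have hzm : z ∈ closedBall z ε := mem_closedBall_self hε.le
  have h01 : Set.uIoc (0 : ℝ) 1 ⊆ Set.Icc 0 1 := by
    rw [Set.uIoc_of_le zero_le_one]; exact Set.Ioc_subset_Icc_self
  refine (intervalIntegral.hasFDerivAt_integral_of_dominated_of_fderiv_le
    (F := fun w t => f (l t w)) (F' := fun w t => (fderiv ℂ f (l t w)).comp (L t))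
    (bound := fun _ => C) (closedBall_mem_nhds z hε) ?_ ?_ ?_ ?_ ?_ ?_).differentiableAt
  · filter_upwards [closedBall_mem_nhds z hε] with w hw
    exact ((hcont w hw).intervalIntegrable).aestronglyMeasurable_restrict_uIoc
  · exact (hcont z hzm).intervalIntegrable
  · refine ContinuousOn.aestronglyMeasurable ?_ measurableSet_uIoc
    exact hF'c.comp (by fun_prop : Continuous fun t : ℝ => (z, t)).continuousOn
      fun t ht => ⟨hzm, h01 ht⟩
  · exact Eventually.of_forall fun t ht w hw => hC (w, t) ⟨hw, h01 ht⟩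
  · exact intervalIntegrable_const
  · refine Eventually.of_forall fun t ht w hw => ?_
    exact ((hf _ (hmem w hw t (h01 ht))).differentiableAt.hasFDerivAt).comp w (hlL t w)

/-- With the second variable frozen, `f` has a primitive `P` on a disc, and the segment integral
equals `P x - P a`. -/
theorem hasDerivAt_segInt {f : ℂ × ℂ → ℂ} {c : ℂ × ℂ} {ρ : ℝ}
    (hf : AnalyticOnNhd ℂ f (ball c ρ)) {a : ℂ} (ha : a ∈ ball c.1 ρ) {z : ℂ × ℂ}
    (hz : z ∈ ball c ρ) : HasDerivAt (fun x => segInt f a (x, z.2)) (f z) z.1 := by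
  have hz' : z.1 ∈ ball c.1 ρ ∧ z.2 ∈ ball c.2 ρ := by
    rwa [← Prod.mk.eta (p := c), ← ball_prod_same] at hz
  have hmem : ∀ x ∈ ball c.1 ρ, (x, z.2) ∈ ball c ρ := fun x hx => by
    rw [← Prod.mk.eta (p := c), ← ball_prod_same]; exact ⟨hx, hz'.2⟩
  have hd : DifferentiableOn ℂ (fun x => f (x, z.2)) (ball c.1 ρ) :=
    hf.differentiableOn.comp (by fun_prop) hmem
  obtain ⟨P, hP⟩ := hd.isExactOn_ball
  have hseg : ∀ x ∈ ball c.1 ρ, segInt f a (x, z.2) = P x - P a := by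
    intro x hx
    have hm : ∀ t ∈ Set.uIcc (0 : ℝ) 1, (a + t * (x - a) : ℂ) ∈ ball c.1 ρ := by
      intro t ht
      rw [Set.uIcc_of_le zero_le_one] at ht
      have := lineMap_mem_ball ha (hmem x hx) ht
      rw [← Prod.mk.eta (p := c), ← ball_prod_same] at this
      exact this.1
    have hder : ∀ t ∈ Set.uIcc (0 : ℝ) 1, HasDerivAt (fun t : ℝ => P (a + t * (x - a)))
        (f (a + t * (x - a), z.2) * (x - a)) t := by
      intro t ht
      have h1 : HasDerivAt (fun t : ℝ => (a + t * (x - a) : ℂ)) (1 * (x - a)) t :=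
        (Complex.ofRealCLM.hasDerivAt.mul_const (x - a)).const_add a
      rw [one_mul] at h1
      exact (hP _ (hm t ht)).comp t h1
    have := intervalIntegral.integral_eq_sub_of_hasDerivAt hder (ContinuousOn.intervalIntegrable ?_)
    · simpa [segInt] using this
    · refine ContinuousOn.mul (hd.continuousOn.comp ?_ hm) continuousOn_const
      fun_prop
  refine ((hP z.1 hz'.1).sub_const (P a)).congr_of_eventuallyEq ?_
  filter_upwards [isOpen_ball.mem_nhds hz'.1] with x hx using hseg x hx

/-- A primitive with respect to the first variable of the germs of a continuation can be continued
along a path on which the second variable is constant. -/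
theorem IsCont.exists_primitive {p : I → ℂ × ℂ} (hp : Continuous p) {b : ℂ}
    (hpb : ∀ s, (p s).2 = b) {f : I → ℂ × ℂ → ℂ} (hf : IsCont p f)
    (hfa : ∀ s, AnalyticAt ℂ (f s) (p s)) {g₀ : ℂ × ℂ → ℂ} (hg₀ : HolAt g₀ (p 0))
    (hg₀' : ∀ᶠ z in 𝓝 (p 0), HasDerivAt (fun x => g₀ (x, z.2)) (f 0 z) z.1) :
    ∃ K : I → ℂ × ℂ → ℂ, K 0 = g₀ ∧ IsCont p K := by
  refine exists_isCont_of_local hp (fun s g => HolAt g (p s) ∧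
    ∀ᶠ z in 𝓝 (p s), HasDerivAt (fun x => g (x, z.2)) (f s z) z.1) (fun s g h => h.1) ?_
    ⟨hg₀, hg₀'⟩
  intro s₀
  obtain ⟨ρ, hρ, hana⟩ := Metric.eventually_nhds_iff_ball.1 (hfa s₀).eventually_analyticAt
  obtain ⟨U, hU, hUo, hs⟩ := _root_.eventually_nhds_iff.1
      ((hp.continuousAt.eventually (ball_mem_nhds (p s₀) hρ)).and (hf s₀).2)
  refine ⟨U, hUo, hs, fun a ha g hg => ?_⟩
  have hpa : p a = ((p a).1, b) := Prod.ext rfl (hpb a)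
  have ha1 : (p a).1 ∈ ball (p s₀).1 ρ := by
    have := (hU a ha).1
    rw [Prod.dist_eq] at this
    exact (max_lt_iff.1 this).1
  -- The integration constant is the function `g ((p a).1, ·)` of the second variable. It is
  -- holomorphic near `b`, and as the second coordinate of `p` is always `b`, this is enough all
  -- along `U`.
  refine ⟨fun z => g ((p a).1, z.2) + segInt (f s₀) (p a).1 z, ?_, fun s hs => ⟨?_, ?_⟩⟩
  · obtain ⟨ε, hε, h⟩ := Metric.eventually_nhds_iff_ball.1
      ((Filter.Eventually.and (p := fun z => z ∈ ball (p s₀) ρ)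
        (isOpen_ball.mem_nhds (hU a ha).1) (hg.2.and (hU a ha).2)))
    filter_upwards [ball_mem_nhds (p a) hε] with z hz
    have hz' : z.1 ∈ ball (p a).1 ε ∧ z.2 ∈ ball (p a).2 ε := by
      rwa [← Prod.mk.eta (p := p a), ← ball_prod_same] at hz
    have hmem : ∀ x ∈ ball (p a).1 ε, (x, z.2) ∈ ball (p a) ε := fun x hx => by
      rw [← Prod.mk.eta (p := p a), ← ball_prod_same]; exact ⟨hx, hz'.2⟩
    have hd1 : ∀ x ∈ ball (p a).1 ε, HasDerivAt
        (fun x => g ((p a).1, z.2) + segInt (f s₀) (p a).1 (x, z.2)) (f s₀ (x, z.2)) x :=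
      fun x hx => (hasDerivAt_segInt hana ha1 (h _ (hmem x hx)).1).const_add _
    have hd2 : ∀ x ∈ ball (p a).1 ε, HasDerivAt (fun x => g (x, z.2)) (f s₀ (x, z.2)) x := by
      intro x hx
      have := (h _ (hmem x hx)).2
      rw [← this.2]; exact this.1
    have := isOpen_ball.eqOn_of_deriv_eq (convex_ball (p a).1 ε).isPreconnected
      (fun x hx => (hd1 x hx).differentiableAt.differentiableWithinAt)
      (fun x hx => (hd2 x hx).differentiableAt.differentiableWithinAt)
      (fun x hx => (hd1 x hx).deriv.trans (hd2 x hx).deriv.symm) (mem_ball_self hε)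
      (by simp [segInt_self])
    exact this hz'.1
  · refine HolAt.add ?_ ?_
    · have h1 : HolAt g ((fun z : ℂ × ℂ => ((p a).1, z.2)) (p s)) := by
        simp only [hpb s]; rw [← hpa]; exact hg.1
      exact h1.comp (l := fun z : ℂ × ℂ => ((p a).1, z.2)) (by fun_prop)
    · exact holAt_of_differentiableOn (U := ball (p s₀) ρ)
        (fun z hz => (differentiableAt_segInt hana ha1 hz).differentiableWithinAt) isOpen_ball
        (hU s hs).1
  · filter_upwards [(hU s hs).2, isOpen_ball.mem_nhds (hU s hs).1] with z h1 h2
    rw [h1]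
    exact (hasDerivAt_segInt hana ha1 h2).const_add _

end Primitive

/-! ### Distance to the lattice, and symmetric families of paths avoiding it. -/

section Lattice

theorem zero_mem_lattice : (0 : ℂ) ∈ lattice := ⟨0, by simp⟩

theorem add_mem_lattice {z w : ℂ} (hz : z ∈ lattice) (hw : w ∈ lattice) : z + w ∈ lattice := by
  obtain ⟨m, rfl⟩ := hz
  obtain ⟨n, rfl⟩ := hw
  exact ⟨m + n, by push_cast; ring⟩

theorem isClosed_lattice : IsClosed lattice := by
  have h : lattice = (fun z : ℂ => z / (2 * Real.pi * Complex.I)) ⁻¹' Set.range ((↑) : ℤ → ℂ) := by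
    ext z
    have := Complex.two_pi_I_ne_zero
    simp only [lattice, Set.mem_ofPred_eq, Set.mem_preimage, Set.mem_range]
    refine exists_congr fun n => ?_
    rw [eq_div_iff this, mul_comm, eq_comm]
  rw [h]
  exact Complex.isClosedEmbedding_intCast.isClosed_range.preimage (by fun_prop)

theorem notMem_lattice_of_norm_lt {z : ℂ} (h0 : z ≠ 0) (h : ‖z‖ < 2 * Real.pi) :
    z ∉ lattice := by
  rintro ⟨n, rfl⟩
  have hn : n ≠ 0 := by rintro rfl; simp at h0
  have h1 : (1 : ℝ) ≤ |(n : ℝ)| := by exact_mod_cast Int.one_le_abs hn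
  have h2 : ‖2 * Real.pi * Complex.I * (n : ℂ)‖ = 2 * Real.pi * |(n : ℝ)| := by
    simp [abs_of_pos Real.pi_pos]
  rw [h2] at h
  nlinarith [Real.pi_pos]

/-- The distance to the lattice. -/
noncomputable def latDist (z : ℂ) : ℝ := infDist z lattice

theorem continuous_latDist : Continuous latDist := continuous_infDist_pt _

theorem latDist_nonneg (z : ℂ) : 0 ≤ latDist z := infDist_nonneg

theorem latDist_pos {z : ℂ} (hz : z ∉ lattice) : 0 < latDist z :=
  (isClosed_lattice.notMem_iff_infDist_pos ⟨0, zero_mem_lattice⟩).1 hz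

theorem latDist_zero : latDist 0 = 0 := infDist_zero_of_mem zero_mem_lattice

/-- If `l` and `m` are lattice points close to `w` and `z - w`, then `l + m` is a lattice point
close to `z`. Stability of `2πiℤ` under addition is essential here. -/
theorem latDist_le_add (z w : ℂ) : latDist z ≤ latDist w + latDist (z - w) := by
  refine le_of_forall_pos_le_add fun ε hε => ?_
  obtain ⟨l, hl, h1⟩ := (infDist_lt_iff ⟨0, zero_mem_lattice⟩).1
    (lt_add_of_pos_right (latDist w) (half_pos hε))
  obtain ⟨m, hm, h2⟩ := (infDist_lt_iff ⟨0, zero_mem_lattice⟩).1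
    (lt_add_of_pos_right (latDist (z - w)) (half_pos hε))
  have h3 : latDist z ≤ dist z (l + m) := infDist_le_dist_of_mem (add_mem_lattice hl hm)
  have h4 : dist z (l + m) ≤ dist w l + dist (z - w) m := by
    simp only [dist_eq_norm]
    calc ‖z - (l + m)‖ = ‖(w - l) + (z - w - m)‖ := by congr 1; ring
      _ ≤ _ := norm_add_le _ _
  linarith

/-- The weight with which the point `x` is dragged when the extremity `z` moves. -/
noncomputable def dragWeight (z x : ℂ) : ℝ := latDist x / (latDist x + latDist (z - x))

theorem add_latDist_pos {z : ℂ} (hz : z ∉ lattice) (x : ℂ) : 0 < latDist x + latDist (z - x) :=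
  (latDist_pos hz).trans_le (latDist_le_add z x)

theorem continuous_dragWeight {z : ℂ} (hz : z ∉ lattice) : Continuous (dragWeight z) :=
  continuous_latDist.div (continuous_latDist.add (continuous_latDist.comp (by fun_prop)))
    fun x => (add_latDist_pos hz x).ne'

theorem dragWeight_zero (z : ℂ) : dragWeight z 0 = 0 := by simp [dragWeight, latDist_zero]

/-- The weights of `x` and `z - x` add up to `1`, so after dragging by `v` the two points have sum
`z + v`: the symmetry about the midpoint survives. -/
theorem dragWeight_sub {z : ℂ} (hz : z ∉ lattice) (x : ℂ) :
    dragWeight z (z - x) = 1 - dragWeight z x := by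
  have := (add_latDist_pos hz x).ne'
  have h' : latDist (z - x) + latDist x ≠ 0 := by rwa [add_comm]
  rw [dragWeight, dragWeight, sub_sub_cancel]
  field_simp
  ring

/-- Dragging a point by a small displacement does not make it reach the lattice. -/
theorem drag_notMem_lattice {z x v : ℂ} (hz : z ∉ lattice) (hx : x ∉ lattice)
    (hv : ‖v‖ < latDist z) : x + dragWeight z x * v ∉ lattice := by
  intro hl
  have h1 : latDist x ≤ dragWeight z x * ‖v‖ := by
    have : latDist x ≤ dist x (x + dragWeight z x * v) := infDist_le_dist_of_mem hl
    have hw : 0 ≤ dragWeight z x :=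
      div_nonneg (latDist_nonneg x) (add_latDist_pos hz x).le
    rw [dist_eq_norm, sub_add_cancel_left, norm_neg, norm_mul, Complex.norm_real,
      Real.norm_of_nonneg hw] at this
    exact this
  have h2 := add_latDist_pos hz x
  rw [dragWeight, div_mul_eq_mul_div, le_div_iff₀ h2] at h1
  have h3 := latDist_le_add z x
  have h4 := latDist_pos hx
  nlinarith

/-- A continuous family of paths from `0` to the points of `γ`, stopped at time `a`, which avoid
the lattice and are symmetric with respect to their midpoints. -/
structure IsSymmFamily (γ : I → ℂ) (a : I) (H : I → I → ℂ) : Prop where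
  cont : Continuous fun p : I × I => H p.1 p.2
  source : ∀ t, H t 0 = 0
  start : ∀ s, H 0 s = 0
  symm : ∀ t s, H t (unitInterval.symm s) = γ (min t a) - H t s
  avoid : ∀ t s, 0 < t → 0 < s → H t s ∉ lattice

/-- For `t ≥ a` the old path ends at `γ a`, and its points are dragged by the displacement of the
extremity since time `a`. For `t ≤ a` this displacement is zero and nothing changes. -/
theorem IsSymmFamily.step {γ : I → ℂ} (hγ : Continuous γ) {a b : I} (hab : a ≤ b)
    (ha : γ a ∉ lattice) (hd : ∀ t ∈ Set.Icc a b, ‖γ t - γ a‖ < latDist (γ a)) {H : I → I → ℂ}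
    (hH : IsSymmFamily γ a H) : ∃ H', IsSymmFamily γ b H' := by
  have hle : ∀ t, t ≤ a → γ (min t b) - γ (min t a) = 0 := fun t ht => by
    rw [min_eq_left ht, min_eq_left (ht.trans hab), sub_self]
  refine ⟨fun t s => H t s + dragWeight (γ a) (H t s) * (γ (min t b) - γ (min t a)),
    ⟨?_, fun t => ?_, fun s => ?_, fun t s => ?_, fun t s ht hs => ?_⟩⟩
  · have h1 := Complex.continuous_ofReal.comp ((continuous_dragWeight ha).comp hH.cont)
    exact hH.cont.add (h1.mul (by fun_prop))
  · simp [hH.source, dragWeight_zero]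
  · rw [hle 0 a.2.1, mul_zero, add_zero, hH.start]
  · rcases le_total t a with h | h
    · rw [hle t h, mul_zero, mul_zero, add_zero, add_zero, hH.symm, ← sub_eq_zero.1 (hle t h)]
    · rw [hH.symm, min_eq_right h, dragWeight_sub ha]
      push_cast; ring
  · rcases le_total t a with h | h
    · simpa [hle t h] using hH.avoid t s ht hs
    · refine drag_notMem_lattice ha (hH.avoid t s ht hs) ?_
      rw [min_eq_right h]
      exact hd _ ⟨le_min h hab, min_le_right _ _⟩

/-- As long as `γ` stays within `2π` of the origin, the straight segments `[0, γ t]` do. From then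
on `latDist ∘ γ` has a positive lower bound `d`, and finitely many dragging steps over intervals on
which `γ` varies by less than `d` reach time `1`. -/
theorem exists_isSymmFamily {γ : I → ℂ} (hγ : Continuous γ) (h0 : γ 0 = 0)
    (hadm : ∀ t, 0 < t → γ t ∉ lattice) : ∃ H, IsSymmFamily γ 1 H := by
  obtain ⟨t₀, ht₀, hsmall⟩ : ∃ t₀ : I, 0 < t₀ ∧ ∀ t ≤ t₀, ‖γ t‖ < 2 * Real.pi := by
    have h1 : ∀ᶠ t in 𝓝 (0 : I), ‖γ t‖ < 2 * Real.pi :=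
      (hγ.norm.tendsto' 0 0 (by simp [h0])).eventually_lt_const (by positivity)
    obtain ⟨ε, hε, h2⟩ := Metric.eventually_nhds_iff.1 h1
    refine ⟨⟨min 1 (ε / 2), by positivity, min_le_left _ _⟩, ?_, fun t ht => h2 ?_⟩
    · exact Subtype.mk_lt_mk.2 (by positivity)
    · have h3 : (t : ℝ) ≤ ε / 2 := (show (t : ℝ) ≤ min 1 (ε / 2) from ht).trans (min_le_right _ _)
      rw [Subtype.dist_eq, Real.dist_eq, Set.Icc.coe_zero, sub_zero, abs_of_nonneg t.2.1]
      linarith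
  have hadm' : ∀ t, t₀ ≤ t → γ t ∉ lattice := fun t ht => hadm t (ht₀.trans_le ht)
  have hinit : IsSymmFamily γ t₀ (fun t s => (s : ℝ) * γ (min t t₀)) := by
    refine ⟨by fun_prop, by simp, fun s => ?_, fun t s => ?_, fun t s ht hs => ?_⟩
    · rw [min_eq_left (unitInterval.nonneg' : 0 ≤ t₀), h0, mul_zero]
    · rw [unitInterval.coe_symm_eq]; push_cast; ring
    · have hpos : 0 < min t t₀ := lt_min ht ht₀
      have hne : γ (min t t₀) ≠ 0 := fun h => hadm _ hpos (h ▸ zero_mem_lattice)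
      refine notMem_lattice_of_norm_lt ?_ ?_
      · refine mul_ne_zero (Complex.ofReal_ne_zero.2 (ne_of_gt ?_)) hne
        exact hs
      · rw [norm_mul, Complex.norm_real, Real.norm_of_nonneg s.2.1]
        exact (mul_le_of_le_one_left (norm_nonneg _) s.2.2).trans_lt (hsmall _ (min_le_right _ _))
  obtain ⟨d, hd, hmin⟩ : ∃ d > 0, ∀ t, t₀ ≤ t → d ≤ latDist (γ t) := by
    obtain ⟨m, hm, h⟩ := (isCompact_Icc (a := t₀) (b := 1)).exists_isMinOn ⟨t₀, le_rfl, t₀.2.2⟩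
      (continuous_latDist.comp hγ).continuousOn
    exact ⟨_, latDist_pos (hadm' m hm.1), fun t ht => h ⟨ht, t.2.2⟩⟩
  obtain ⟨t, ht0, htm, ⟨N, hN⟩, ht⟩ := exists_monotone_Icc_subset_open_cover_unitInterval
    (c := fun i : I => γ ⁻¹' ball (γ i) (d / 2)) (fun i => isOpen_ball.preimage hγ)
    (fun s _ => Set.mem_iUnion.2 ⟨s, mem_ball_self (half_pos hd)⟩)
  have key : ∀ n, ∃ H, IsSymmFamily γ (max t₀ (t n)) H := by
    intro n
    induction n with
    | zero => rw [ht0, max_eq_left (unitInterval.nonneg' : 0 ≤ t₀)]; exact ⟨_, hinit⟩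
    | succ n ih =>
      obtain ⟨H, hH⟩ := ih
      refine hH.step hγ (max_le_max le_rfl (htm n.le_succ)) (hadm' _ (le_max_left _ _)) ?_
      intro u hu
      refine lt_of_lt_of_le ?_ (hmin _ (le_max_left _ _))
      obtain ⟨i, hi⟩ := ht n
      rcases le_total (t (n + 1)) t₀ with h | h
      · have h1 := (htm n.le_succ).trans h
        rw [max_eq_left h, max_eq_left h1] at hu
        rw [max_eq_left h1, le_antisymm hu.2 hu.1, sub_self, norm_zero]
        exact hd
      · rw [max_eq_right h] at hu
        have h1 := hi ⟨(le_max_right _ _).trans hu.1, hu.2⟩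
        have h2 := hi ⟨le_max_right t₀ (t n), max_le h (htm n.le_succ)⟩
        rw [← dist_eq_norm]
        have := dist_triangle_right (γ u) (γ (max t₀ (t n))) (γ i)
        rw [Set.mem_preimage, mem_ball] at h1 h2
        linarith
  obtain ⟨H, hH⟩ := key N
  rw [hN N le_rfl, max_eq_right (unitInterval.le_one' : t₀ ≤ 1)] at hH
  exact ⟨H, hH⟩

end Lattice

/-! ### Continuation of the convolution along admissible paths. -/

/-- The germ of `φ` at the origin admits analytic continuation along all admissible paths. -/
def ContAlong (φ : ℂ → ℂ) : Prop :=
  ∀ γ : I → ℂ, Continuous γ → γ 0 = 0 → ((∀ t, γ t = 0) ∨ ∀ t, 0 < t → γ t ∉ lattice) →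
    ∃ F : I → ℂ → ℂ, F 0 =ᶠ[𝓝 0] φ ∧ IsCont γ F

theorem segInt_congr {f g : ℂ × ℂ → ℂ} {a b : ℂ} (h : f =ᶠ[𝓝 (a, b)] g) :
    segInt f a =ᶠ[𝓝 (a, b)] segInt g a := by
  obtain ⟨ε, hε, h⟩ := Metric.eventually_nhds_iff_ball.1 h
  filter_upwards [ball_mem_nhds _ hε] with z hz
  refine intervalIntegral.integral_congr fun t ht => ?_
  rw [Set.uIcc_of_le zero_le_one] at ht
  rw [h _ (lineMap_mem_ball (mem_ball_self hε) hz ht)]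

theorem holAt_segInt {f : ℂ × ℂ → ℂ} {a b : ℂ} (hf : AnalyticAt ℂ f (a, b)) :
    HolAt (segInt f a) (a, b) ∧
      ∀ᶠ z in 𝓝 (a, b), HasDerivAt (fun x => segInt f a (x, z.2)) (f z) z.1 := by
  obtain ⟨ρ, hρ, hana⟩ := Metric.eventually_nhds_iff_ball.1 hf.eventually_analyticAt
  constructor
  · filter_upwards [ball_mem_nhds _ hρ] with z hz
      using differentiableAt_segInt hana (mem_ball_self hρ) hz
  · filter_upwards [ball_mem_nhds _ hρ] with z hz
      using hasDerivAt_segInt hana (mem_ball_self hρ) hz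

theorem convolution_eq_segInt (φ ψ : ℂ → ℂ) (ζ : ℂ) :
    convolution φ ψ ζ = segInt (fun z => φ z.1 * ψ (z.2 - z.1)) 0 (ζ, ζ) := by
  simp [convolution, segInt]

/-- The germ in `(ζ₁, ζ)` of the integrand of the convolution. -/
theorem analyticAt_integrand {φ ψ : ℂ → ℂ} {z : ℂ × ℂ} (hφ : AnalyticAt ℂ φ z.1)
    (hψ : AnalyticAt ℂ ψ (z.2 - z.1)) :
    AnalyticAt ℂ (fun z : ℂ × ℂ => φ z.1 * ψ (z.2 - z.1)) z :=
  (hφ.fun_comp analyticAt_fst).mul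
    (hψ.fun_comp (f := fun z : ℂ × ℂ => z.2 - z.1) (analyticAt_snd.sub analyticAt_fst))

theorem integrand_congr {φ φ' ψ ψ' : ℂ → ℂ} {z : ℂ × ℂ} (hφ : φ =ᶠ[𝓝 z.1] φ')
    (hψ : ψ =ᶠ[𝓝 (z.2 - z.1)] ψ') :
    (fun z : ℂ × ℂ => φ z.1 * ψ (z.2 - z.1)) =ᶠ[𝓝 z] fun z => φ' z.1 * ψ' (z.2 - z.1) := by
  have h : Continuous fun z : ℂ × ℂ => z.2 - z.1 := by fun_prop
  filter_upwards [continuous_fst.continuousAt.eventually hφ, h.continuousAt.eventually hψ]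
    with w h1 h2
  rw [h1, h2]

theorem ContAlong.analyticAt {φ : ℂ → ℂ} (hφ : ContAlong φ) : AnalyticAt ℂ φ 0 := by
  obtain ⟨F, hF0, hF⟩ := hφ (fun _ => 0) continuous_const rfl (Or.inl fun _ => rfl)
  exact holAt_iff_analyticAt.1 ((hF 0).1.congr hF0.symm)

theorem holAt_diag {K : ℂ × ℂ → ℂ} {ζ : ℂ} (hK : HolAt K (ζ, ζ)) :
    HolAt (fun ζ => K (ζ, ζ)) ζ :=
  hK.comp (l := fun ζ : ℂ => (ζ, ζ)) (by fun_prop)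

theorem eventually_diag {P : ℂ × ℂ → Prop} {ζ : ℂ} (h : ∀ᶠ z in 𝓝 (ζ, ζ), P z) :
    ∀ᶠ w in 𝓝 ζ, P (w, w) :=
  (show Continuous fun w : ℂ => (w, w) by fun_prop).continuousAt.eventually h

/-- The convolution product can be continued along all admissible paths. -/
theorem ContAlong.convolution {φ ψ : ℂ → ℂ} (hφ : ContAlong φ) (hψ : ContAlong ψ) :
    ContAlong (convolution φ ψ) := by
  intro γ hγ hγ0 hadm
  have hconv : Resurgence.convolution φ ψ =
      fun ζ => segInt (fun z => φ z.1 * ψ (z.2 - z.1)) 0 (ζ, ζ) :=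
    funext (convolution_eq_segInt φ ψ)
  rcases hadm with hadm | hadm
  · refine ⟨fun _ => Resurgence.convolution φ ψ, EventuallyEq.rfl, isCont_const fun s => ?_⟩
    rw [hadm s, hconv]
    exact holAt_diag (holAt_segInt (analyticAt_integrand hφ.analyticAt
      (by simpa using hψ.analyticAt))).1
  obtain ⟨H, hH⟩ := exists_isSymmFamily hγ hγ0 hadm
  have hHsymm : ∀ t s, H t (unitInterval.symm s) = γ t - H t s := fun t s => by
    rw [hH.symm, min_eq_left (unitInterval.le_one' : t ≤ 1)]
  have hH1 : ∀ t, H t 1 = γ t := fun t => by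
    simpa [hH.source] using hHsymm t 0
  have hHt : ∀ t, Continuous (H t) :=
    fun t => hH.cont.comp (by fun_prop : Continuous fun s : I => (t, s))
  have hHadm : ∀ t, (∀ s, H t s = 0) ∨ ∀ s, 0 < s → H t s ∉ lattice := by
    intro t
    rcases eq_or_lt_of_le (show 0 ≤ t from t.2.1) with h | h
    · exact Or.inl fun s => h ▸ hH.start s
    · exact Or.inr fun s hs => hH.avoid t s h hs
  choose F hF0 hF using fun t => hφ (H t) (hHt t) (hH.source t) (hHadm t)
  choose G hG0 hG using fun t => hψ (H t) (hHt t) (hH.source t) (hHadm t)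
  -- The germs of `ψ` at the start of all the paths `H t` coincide, so by monodromy the final germs
  -- form a continuation of `ψ` along `γ`.
  have hG1 : IsCont γ fun t => G t 1 := by
    have := IsCont.monodromy hH.cont hG (IsCont.congr (by simpa only [hH.source] using
      continuous_const) (isCont_const (f := ψ) fun t => ?_) fun t => ?_) 1
    · simpa only [hH1] using this
    · rw [hH.source]; exact holAt_iff_analyticAt.2 hψ.analyticAt
    · rw [hH.source]; exact hG0 t
  have hFa : ∀ t s, AnalyticAt ℂ (F t s) (H t s) := fun t s => holAt_iff_analyticAt.1 (hF t s).1
  have hGa : ∀ t s, AnalyticAt ℂ (G t (unitInterval.symm s)) (γ t - H t s) := fun t s => by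
    rw [← hHsymm]; exact holAt_iff_analyticAt.1 (hG t _).1
  set p : I → I → ℂ × ℂ := fun t s => (H t s, γ t) with hp
  -- At `ζ₁ = H t s` the second factor is needed at `γ t - H t s = H t (1 - s)`, where `G t (1 - s)`
  -- provides its germ.
  set f : I → I → ℂ × ℂ → ℂ :=
    fun t s z => F t s z.1 * G t (unitInterval.symm s) (z.2 - z.1) with hf
  have hfa : ∀ t s, AnalyticAt ℂ (f t s) (p t s) := fun t s =>
    analyticAt_integrand (hFa t s) (hGa t s)
  have hfc : ∀ t, IsCont (p t) (f t) := by
    refine fun t s => ⟨?_, ?_⟩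
    · filter_upwards [(hfa t s).eventually_analyticAt] with z hz using hz.differentiableAt
    · filter_upwards [(hF t s).2, unitInterval.continuous_symm.continuousAt.eventually
        (hG t (unitInterval.symm s)).2] with s' h1 h2
      exact integrand_congr h1 (by rwa [hHsymm] at h2)
  have hp0 : ∀ t, p t 0 = (0, γ t) := fun t => by simp [hp, hH.source]
  have hpc : Continuous fun q : I × I => p q.1 q.2 := hH.cont.prodMk (by fun_prop)
  have hinit : ∀ t, HolAt (segInt (f t 0) 0) (p t 0) ∧ ∀ᶠ z in 𝓝 (p t 0),
      HasDerivAt (fun x => segInt (f t 0) 0 (x, z.2)) (f t 0 z) z.1 := fun t => by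
    have := hfa t 0
    rw [hp0] at this ⊢
    exact holAt_segInt this
  choose K hK0 hK using fun t => IsCont.exists_primitive
    (hpc.comp (by fun_prop : Continuous fun s : I => (t, s))) (fun s => rfl) (hfc t) (hfa t)
    (hinit t).1 (hinit t).2
  replace hK : ∀ t, IsCont (p t) (K t) := hK
  have hKend : IsCont (fun t => p t 1) fun t => K t 1 := by
    -- At `s = 0` the first factor is the germ of `φ` for every `t`, and the second is `G t 1`,
    -- whose compatibility in `t` is `hG1`.
    refine IsCont.monodromy hpc hK (fun t => ⟨(hK t 0).1, ?_⟩) 1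
    filter_upwards [(hG1 t).2] with t' ht'
    rw [hK0, hK0, hp0]
    refine segInt_congr (integrand_congr ((hF0 t').trans (hF0 t).symm) ?_)
    simpa using ht'
  simp only [hp, hH1] at hKend
  refine ⟨fun t ζ => K t 1 (ζ, ζ), ?_, fun t => ⟨holAt_diag (hKend t).1, ?_⟩⟩
  -- At `t = 0` all the paths are constant, so the germs do not change along them and the initial
  -- segment integral, that is the convolution itself, is recovered.
  · have hconst : p 0 = fun _ => (0, 0) := funext fun s => by simp [hp, hH.start, hγ0]
    have h1 : K 0 1 =ᶠ[𝓝 (0, 0)] K 0 0 := by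
      have h := hK 0
      rw [hconst] at h
      exact h.unique continuous_const (isCont_const fun _ => (h 0).1) (s₀ := 0) EventuallyEq.rfl 1
    have h2 : G 0 1 =ᶠ[𝓝 0] G 0 0 := by
      have h := hG 0
      rw [show H 0 = fun _ => 0 from funext hH.start] at h
      exact h.unique continuous_const (isCont_const fun _ => (h 0).1) (s₀ := 0) EventuallyEq.rfl 1
    have h3 : K 0 0 =ᶠ[𝓝 (0, 0)] segInt (fun z => φ z.1 * ψ (z.2 - z.1)) 0 := by
      rw [hK0]
      refine segInt_congr (integrand_congr (hF0 0) ?_)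
      simpa using h2.trans (hG0 0)
    rw [hconv]
    exact eventually_diag (h1.trans h3)
  · filter_upwards [(hKend t).2] with t' ht' using eventually_diag ht'

/-! ### Functions on the surface and continuation along admissible paths. -/

section Surface

theorem admHomotopic_of_family {w : ℂ} {p q : AdmPath w} {K : I → I → ℂ}
    (hK : Continuous fun x : I × I => K x.1 x.2) (h0 : ∀ t, K 0 t = p.1 t)
    (h1 : ∀ t, K 1 t = q.1 t) (hs : ∀ s, K s 0 = 0) (hw : ∀ s, K s 1 = w)
    (hadm : ∀ s, (∀ t, K s t = 0) ∨ ∀ t, 0 < t → K s t ∉ lattice) : AdmHomotopic p q := by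
  refine ⟨⟨⟨⟨fun x => K x.1 x.2, hK⟩, h0, h1⟩, ?_⟩, hadm⟩
  rintro s t (rfl | rfl)
  · simpa using hs s
  · simpa using hw s

theorem segment_mem_ball {z w c : ℂ} {r : ℝ} (hz : z ∈ ball c r) (hw : w ∈ ball c r) (t : I) :
    Path.segment z w t ∈ ball c r :=
  (convex_ball c r).segment_subset hz hw (by
    rw [← Path.range_segment]; exact Set.mem_range_self t)

theorem notMem_lattice_of_mem_ball {z w : ℂ} (hw : w ∈ ball z (latDist z)) : w ∉ lattice := by
  intro h
  have := infDist_le_dist_of_mem (x := z) h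
  rw [mem_ball'] at hw
  exact absurd hw (not_lt.2 this)

theorem admissible_segment {w : ℂ} (hw : ‖w‖ < 2 * Real.pi) : Admissible (Path.segment 0 w) := by
  rcases eq_or_ne w 0 with rfl | h
  · exact Or.inl fun t => by simp [Path.segment_same]
  · refine Or.inr fun t ht => ?_
    have e : Path.segment 0 w t = (t : ℝ) * w := by simp [Path.segment_apply, AffineMap.lineMap_apply]
    rw [e]
    refine notMem_lattice_of_norm_lt ?_ ?_
    · exact mul_ne_zero (Complex.ofReal_ne_zero.2 (ne_of_gt (Subtype.coe_lt_coe.2 ht))) h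
    · rw [norm_mul, Complex.norm_real, Real.norm_of_nonneg t.2.1]
      exact (mul_le_of_le_one_left (norm_nonneg _) t.2.2).trans_lt hw

theorem eventually_norm_lt_two_pi : ∀ᶠ w in 𝓝 (0 : ℂ), ‖w‖ < 2 * Real.pi := by
  have : (0 : ℝ) < 2 * Real.pi := by positivity
  filter_upwards [ball_mem_nhds (0 : ℂ) this] with w hw using by simpa using hw

theorem RSurface.move_of_eq_zero {c : RSurface} (hc : c.1 = 0) {w : ℂ}
    (hw : Admissible (Path.segment 0 w)) : c.move w = RSurface.mk ⟨Path.segment 0 w, hw⟩ := by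
  rw [RSurface.move, dif_pos hc, dif_pos hw]

theorem RSurface.move_mk {ζ w : ℂ} (γ : AdmPath ζ) (h0 : ζ ≠ 0)
    (hw : ∀ t, Path.segment ζ w t ∉ lattice) :
    (RSurface.mk γ).move w = RSurface.mk (γ.append h0 hw) := by
  have h0' : ¬ (RSurface.mk γ).1 = 0 := h0
  have hw' : ∀ t, Path.segment (RSurface.mk γ).1 w t ∉ lattice := hw
  exact (dif_neg h0').trans (dif_pos hw')

theorem RSurface.mk_eq_mk {ζ : ℂ} {γ₀ γ₁ : AdmPath ζ} (h : AdmHomotopic γ₀ γ₁) :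
    RSurface.mk γ₀ = RSurface.mk γ₁ :=
  congrArg (Sigma.mk ζ) (Quotient.sound (s := admSetoid ζ) h)

/-- A path which stays close to the origin is homotopic to the segment with the same extremity. -/
theorem admHomotopic_segment {w : ℂ} (p : AdmPath w) (hp : ∀ t, ‖p.1 t‖ < 2 * Real.pi)
    (hw : Admissible (Path.segment 0 w)) : AdmHomotopic p ⟨Path.segment 0 w, hw⟩ := by
  -- At stage `s` the path goes straight from `0` to `p s` for `t ≤ s`, then follows `p`. At `s = t
  -- = 0` the quotient is `0 / 0 = 0`, and continuity there comes from the bound of `K s t` by the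
  -- norm of `p (max s t)`.
  set K : I → I → ℂ := fun s t => ((t : ℝ) / (max s t : I) : ℝ) * p.1 (max s t) with hK
  have hle : ∀ s t : I, ((t : ℝ) / (max s t : I) : ℝ) ≤ 1 := fun s t =>
    div_le_one_of_le₀ (le_max_right s t : t ≤ max s t) (max s t).2.1
  have hnn : ∀ s t : I, 0 ≤ ((t : ℝ) / (max s t : I) : ℝ) := fun s t =>
    div_nonneg t.2.1 (max s t).2.1
  refine admHomotopic_of_family (K := K) ?_ (fun t => ?_) (fun t => ?_) (fun s => ?_) (fun s => ?_)
    fun s => ?_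
  · refine continuous_iff_continuousAt.2 fun x => ?_
    have hmax : Continuous fun x : I × I => max x.1 x.2 := by fun_prop
    by_cases hx : max x.1 x.2 = 0
    · have hb : ∀ y : I × I, ‖K y.1 y.2‖ ≤ ‖p.1 (max y.1 y.2)‖ := fun y => by
        simp only [hK]
        rw [norm_mul, Complex.norm_real, Real.norm_of_nonneg (hnn _ _)]
        exact mul_le_of_le_one_left (norm_nonneg _) (hle _ _)
      have hlim : Tendsto (fun y : I × I => ‖p.1 (max y.1 y.2)‖) (𝓝 x) (𝓝 0) :=
        (p.1.continuous.comp hmax).norm.tendsto' x 0 (by simp [hx])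
      have h0 : K x.1 x.2 = 0 := by
        have := hb x
        rw [hx, p.1.source, norm_zero] at this
        exact norm_le_zero_iff.1 this
      rw [ContinuousAt, h0]
      exact squeeze_zero_norm hb hlim
    · refine ContinuousAt.mul ?_ (p.1.continuous.comp hmax).continuousAt
      refine Complex.continuous_ofReal.continuousAt.comp ?_
      refine ContinuousAt.div (by fun_prop) (continuous_subtype_val.comp hmax).continuousAt ?_
      exact fun h => hx (Subtype.ext h)
  · rcases eq_or_ne t 0 with rfl | ht
    · simp [hK]
    · have : (t : ℝ) ≠ 0 := fun h => ht (Subtype.ext h)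
      simp only [hK, max_eq_right (unitInterval.nonneg' : 0 ≤ t)]
      rw [div_self this]; simp
  · simp only [hK, max_eq_left (unitInterval.le_one' : t ≤ 1)]
    simp [Path.segment_apply, AffineMap.lineMap_apply]
  · simp [hK]
  · have : max s 1 = 1 := max_eq_right unitInterval.le_one'
    simp only [hK]
    rw [this]; simp
  · rcases p.2 with h | h
    · exact Or.inl fun t => by simp [hK, h]
    · refine Or.inr fun t ht => ?_
      have hm : 0 < max s t := ht.trans_le (le_max_right _ _)
      refine notMem_lattice_of_norm_lt (mul_ne_zero (Complex.ofReal_ne_zero.2 ?_) ?_) ?_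
      · exact (div_pos (Subtype.coe_lt_coe.2 ht) (Subtype.coe_lt_coe.2 hm)).ne'
      · exact fun h' => h _ hm (by rw [h']; exact zero_mem_lattice)
      · rw [norm_mul, Complex.norm_real, Real.norm_of_nonneg (hnn _ _)]
        exact (mul_le_of_le_one_left (norm_nonneg _) (hle _ _)).trans_lt (hp _)

/-- The restriction of `γ` to `[0, t]`, reparametrised. -/
def initialPath (γ : I → ℂ) (hγ : Continuous γ) (h0 : γ 0 = 0) (t : I) : Path 0 (γ t) where
  toFun s := γ (t * s)
  continuous_toFun := by fun_prop
  source' := by simp [h0]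
  target' := by simp

theorem initialPath_apply {γ : I → ℂ} (hγ : Continuous γ) (h0 : γ 0 = 0) (t s : I) :
    initialPath γ hγ h0 t s = γ (t * s) := rfl

theorem admissible_initialPath {γ : I → ℂ} (hγ : Continuous γ) (h0 : γ 0 = 0)
    (hadm : (∀ t, γ t = 0) ∨ ∀ t, 0 < t → γ t ∉ lattice) (t : I) :
    Admissible (initialPath γ hγ h0 t) := by
  rcases hadm with h | h
  · exact Or.inl fun s => h _
  · rcases eq_or_lt_of_le (unitInterval.nonneg' : 0 ≤ t) with ht | ht
    · subst ht; exact Or.inl fun s => by rw [initialPath_apply, zero_mul, h0]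
    · exact Or.inr fun s hs => h _ (show (0 : ℝ) < t * s from mul_pos ht hs)

/-- Moving the point where one leaves `γ` along a segment does not change the homotopy class, as
long as everything takes place in a ball that does not meet the lattice. -/
theorem admHomotopic_append {γ : I → ℂ} (hγ : Continuous γ) (h0 : γ 0 = 0)
    (hadm : (∀ t, γ t = 0) ∨ ∀ t, 0 < t → γ t ∉ lattice) {c : ℂ} {r : ℝ}
    (hr : ∀ z ∈ ball c r, z ∉ lattice) {t t' : I}
    (ht : ∀ u ∈ Set.uIcc t t', γ u ∈ ball c r) {w : ℂ} (hw : w ∈ ball c r)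
    (h1 : γ t ≠ 0) (h2 : ∀ s, Path.segment (γ t) w s ∉ lattice)
    (h1' : γ t' ≠ 0) (h2' : ∀ s, Path.segment (γ t') w s ∉ lattice) :
    AdmHomotopic (AdmPath.append h1 h2 ⟨_, admissible_initialPath hγ h0 hadm t⟩)
      (AdmPath.append h1' h2' ⟨_, admissible_initialPath hγ h0 hadm t'⟩) := by
  set u : I → I := fun s => Set.projIcc 0 1 zero_le_one ((1 - s) * t + s * t' : ℝ) with hu
  have huc : Continuous u := continuous_projIcc.comp (by fun_prop)
  have hu0 : u 0 = t := by simp [hu]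
  have hu1 : u 1 = t' := by simp [hu]
  have humem : ∀ s, γ (u s) ∈ ball c r := by
    intro s
    refine ht _ ?_
    have h3 : ((1 - s) * t + s * t' : ℝ) ∈ Set.uIcc (t : ℝ) t' :=
      (convex_uIcc (t : ℝ) t') Set.left_mem_uIcc Set.right_mem_uIcc
        (sub_nonneg.2 s.2.2) s.2.1 (by ring)
    have h4 : ((1 - s) * t + s * t' : ℝ) ∈ Set.Icc (0 : ℝ) 1 :=
      (convex_Icc (0 : ℝ) 1) t.2 t'.2 (sub_nonneg.2 s.2.2) s.2.1 (by ring)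
    simp only [hu]
    rw [Set.projIcc_of_mem _ h4]
    rcases le_total t t' with h | h
    · rw [Set.uIcc_of_le h]
      rw [Set.uIcc_of_le (show (t : ℝ) ≤ t' from h)] at h3
      exact h3
    · rw [Set.uIcc_of_ge h]
      rw [Set.uIcc_of_ge (show (t' : ℝ) ≤ t from h)] at h3
      exact h3
  have key : ∀ v, u 0 = v → ∀ x, ((initialPath γ hγ h0 (u 0)).trans (Path.segment (γ (u 0)) w)) x =
      ((initialPath γ hγ h0 v).trans (Path.segment (γ v) w)) x := by
    rintro v rfl x; rfl
  have key' : ∀ v, u 1 = v → ∀ x, ((initialPath γ hγ h0 (u 1)).trans (Path.segment (γ (u 1)) w)) x =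
      ((initialPath γ hγ h0 v).trans (Path.segment (γ v) w)) x := by
    rintro v rfl x; rfl
  refine admHomotopic_of_family (K := fun s x =>
    ((initialPath γ hγ h0 (u s)).trans (Path.segment (γ (u s)) w)) x) ?_ (key t hu0) (key' t' hu1)
    (fun s => Path.source _) (fun s => Path.target _) fun s => ?_
  · refine Path.trans_continuous_family (fun s => initialPath γ hγ h0 (u s)) ?_
      (fun s => Path.segment (γ (u s)) w) ?_
    · change Continuous fun x : I × I => γ (u x.1 * x.2)
      fun_prop
    · change Continuous fun x : I × I => Path.segment (γ (u x.1)) w x.2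
      simp only [Path.segment_apply, AffineMap.lineMap_apply]
      fun_prop
  · exact (admissible_initialPath hγ h0 hadm (u s)).trans_segment
      (fun h => hr _ (humem s) (h ▸ zero_mem_lattice)) fun x => hr _ (segment_mem_ball (humem s) hw x)

/-- A holomorphic function on the surface provides continuations along all admissible paths. -/
theorem ExtendsToR.contAlong {φ : ℂ → ℂ} (hφ : ExtendsToR φ) : ContAlong φ := by
  obtain ⟨Φ, hΦ, h⟩ := hφ
  intro γ hγ h0 hadm
  set c : I → RSurface := fun t => RSurface.mk ⟨_, admissible_initialPath hγ h0 hadm t⟩ with hc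
  refine ⟨fun t w => Φ ((c t).move w), ?_, fun t => ⟨holAt_iff_analyticAt.2 (hΦ (c t)), ?_⟩⟩
  · filter_upwards [h, eventually_norm_lt_two_pi] with w h1 h2
    rw [← h1, RSurface.move_of_eq_zero (c := c 0) h0 (admissible_segment h2),
      RSurface.move_of_eq_zero (c := RSurface.origin) rfl (admissible_segment h2)]
  -- Compatibility of the germs reduces to the statement that the local inverses of `π` based at `c
  -- t'` and at `c t` agree near `γ t'`.
  suffices hmain : ∀ᶠ t' in 𝓝 t, ∀ᶠ w in 𝓝 (γ t'), (c t').move w = (c t).move w by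
    filter_upwards [hmain] with t' ht'
    filter_upwards [ht'] with w hw
    rw [hw]
  -- Here either `γ` is constant or `t = 0`. `move` then follows the segment from the origin, to
  -- which every admissible path inside the disc of radius `2π` with the same end is homotopic.
  by_cases ht : γ t = 0
  · have hball : (0 : ℝ) < 2 * Real.pi := by positivity
    have hsmall : ∀ᶠ t' in 𝓝 t, γ t' = 0 ∨ ∀ s, ‖γ (t' * s)‖ < 2 * Real.pi := by
      rcases hadm with hadm | hadm
      · exact Eventually.of_forall fun t' => Or.inl (hadm t')
      · have ht0 : t = 0 := by
          by_contra h'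
          exact hadm t (lt_of_le_of_ne unitInterval.nonneg' (Ne.symm h')) (ht ▸ zero_mem_lattice)
        subst ht0
        obtain ⟨ε, hε, h1⟩ := Metric.eventually_nhds_iff_ball.1
          (hγ.continuousAt.eventually (isOpen_ball.mem_nhds
            (show γ 0 ∈ ball (0 : ℂ) (2 * Real.pi) by simpa [h0] using hball)))
        filter_upwards [ball_mem_nhds 0 hε] with t' ht'
        refine Or.inr fun s => ?_
        have := h1 (t' * s) ?_
        · simpa using this
        · rw [mem_ball, Subtype.dist_eq, Real.dist_eq, Set.Icc.coe_zero, sub_zero,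
            abs_of_nonneg (unitInterval.nonneg _)] at ht' ⊢
          exact (mul_le_of_le_one_right t'.2.1 s.2.2).trans_lt ht'
    filter_upwards [hsmall] with t' ht'
    have hnorm : ‖γ t'‖ < 2 * Real.pi := by
      rcases ht' with h1 | h1
      · rw [h1, norm_zero]; exact hball
      · simpa using h1 1
    have hw1 : ∀ᶠ w in 𝓝 (γ t'), w ∈ ball (0 : ℂ) (2 * Real.pi) :=
      isOpen_ball.mem_nhds (by simpa using hnorm)
    by_cases hz : γ t' = 0
    · filter_upwards [hw1] with w h1
      have h1 := admissible_segment (w := w) (by simpa using h1)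
      rw [RSurface.move_of_eq_zero (c := c t) ht h1, RSurface.move_of_eq_zero (c := c t') hz h1]
    · have hsm := ht'.resolve_left hz
      filter_upwards [hw1, ball_mem_nhds _ (norm_pos_iff.2 hz)] with w h1 h2
      have h3 := admissible_segment (w := w) (by simpa using h1)
      have h4 : ∀ s, Path.segment (γ t') w s ∈ ball (0 : ℂ) (2 * Real.pi) :=
        segment_mem_ball (by simpa using hnorm) h1
      have h5 : ∀ s, Path.segment (γ t') w s ∉ lattice := by
        intro s
        refine notMem_lattice_of_norm_lt (fun h6 => ?_) (by simpa using h4 s)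
        have := segment_mem_ball (mem_ball_self (norm_pos_iff.2 hz)) h2 s
        rw [h6] at this
        simp at this
      rw [RSurface.move_of_eq_zero (c := c t) ht h3]
      have h6 : ∀ s, ‖(initialPath γ hγ h0 t').trans (Path.segment (γ t') w) s‖ < 2 * Real.pi := by
        intro s
        rw [Path.trans_apply]
        split_ifs
        · rw [initialPath_apply]; exact hsm _
        · exact mem_ball_zero_iff.1 (h4 _)
      exact (RSurface.move_mk _ hz h5).trans
        (RSurface.mk_eq_mk (admHomotopic_segment _ h6 h3))
  · have htl : γ t ∉ lattice := by
      rcases hadm with hadm | hadm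
      · exact absurd (hadm t) ht
      · refine hadm t (lt_of_le_of_ne unitInterval.nonneg' fun h' => ht ?_)
        rw [← h', h0]
    obtain ⟨ε, hε, h1⟩ := Metric.eventually_nhds_iff_ball.1
      (hγ.continuousAt.eventually (ball_mem_nhds _ (latDist_pos htl)))
    filter_upwards [ball_mem_nhds t hε] with t' ht'
    filter_upwards [isOpen_ball.mem_nhds (h1 t' ht')] with w hw
    have h2 : ∀ z ∈ ball (γ t) (latDist (γ t)), z ∉ lattice :=
      fun z hz => notMem_lattice_of_mem_ball hz
    have h3 : γ t' ≠ 0 := fun h' => h2 _ (h1 t' ht') (h' ▸ zero_mem_lattice)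
    have h4 : ∀ t' ∈ ball t ε, ∀ s, Path.segment (γ t') w s ∉ lattice :=
      fun t' ht' s => h2 _ (segment_mem_ball (h1 t' ht') hw s)
    refine (RSurface.move_mk _ h3 (h4 t' ht')).trans (Eq.trans (RSurface.mk_eq_mk ?_).symm
      (RSurface.move_mk _ ht (h4 t (mem_ball_self hε))).symm)
    refine admHomotopic_append hγ h0 hadm h2 (fun u hu => h1 u ?_) hw _ _ _ _
    rw [mem_ball, Subtype.dist_eq, Real.dist_eq] at ht' ⊢
    refine (Set.abs_sub_left_of_mem_uIcc (a := (t : ℝ)) (b := t') ?_).trans_lt ht'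
    rcases le_total t t' with h | h
    · rw [Set.uIcc_of_le h] at hu
      rw [Set.uIcc_of_le (show (t : ℝ) ≤ t' from h)]; exact hu
    · rw [Set.uIcc_of_ge h] at hu
      rw [Set.uIcc_of_ge (show (t' : ℝ) ≤ t from h)]; exact hu

/-- Homotopic paths lead to the same germ. -/
theorem IsCont.end_eq_of_admHomotopic {φ : ℂ → ℂ} (hφ : ContAlong φ) {ζ : ℂ} {γ γ' : AdmPath ζ}
    (h : AdmHomotopic γ γ') {F F' : I → ℂ → ℂ} (hF : IsCont γ.1 F) (hF0 : F 0 =ᶠ[𝓝 0] φ)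
    (hF' : IsCont γ'.1 F') (hF0' : F' 0 =ᶠ[𝓝 0] φ) : F 1 =ᶠ[𝓝 ζ] F' 1 := by
  obtain ⟨K, hK⟩ := h
  choose G hG0 hG using fun t => hφ (K.eval t) (K.eval t).continuous (K.eval t).source (hK t)
  have h0 : ∀ t, K.eval t 0 = 0 := fun t => (K.eval t).source
  have h1 : ∀ t, K.eval t 1 = ζ := fun t => (K.eval t).target
  -- The end points of the homotopy are fixed, so the final germs form a continuation along a
  -- constant path, and therefore do not vary.
  have hend := IsCont.monodromy (H := fun t s => K.eval t s) K.continuous hG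
    (IsCont.congr (by simpa only [h0] using continuous_const)
      (isCont_const (f := φ) fun t => by
        rw [h0]; exact holAt_iff_analyticAt.2 hφ.analyticAt)
      fun t => by rw [h0]; exact hG0 t) 1
  simp only [h1] at hend
  have h2 : G 1 1 =ᶠ[𝓝 ζ] G 0 1 := hend.unique continuous_const
    (isCont_const fun _ => (hend 0).1) (s₀ := 0) EventuallyEq.rfl 1
  have h3 : G 0 1 =ᶠ[𝓝 ζ] F 1 := by
    have h4 := hG 0
    rw [K.eval_zero] at h4
    have := h4.unique γ.1.continuous hF (s₀ := 0)
      (by rw [γ.1.source]; exact (hG0 0).trans hF0.symm) 1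
    rwa [γ.1.target] at this
  have h5 : G 1 1 =ᶠ[𝓝 ζ] F' 1 := by
    have h4 := hG 1
    rw [K.eval_one] at h4
    have := h4.unique γ'.1.continuous hF' (s₀ := 0)
      (by rw [γ'.1.source]; exact (hG0 1).trans hF0'.symm) 1
    rwa [γ'.1.target] at this
  exact (h3.symm.trans h2.symm).trans h5

/-- Extending a continuation along an additional segment on which the last germ is defined. -/
theorem IsCont.trans_segment {ζ w : ℂ} {γ : Path 0 ζ} {F : I → ℂ → ℂ} (hF : IsCont γ F)
    (hw : ∀ t, HolAt (F 1) (Path.segment ζ w t)) :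
    IsCont (γ.trans (Path.segment ζ w)) fun s => F (Set.projIcc 0 1 zero_le_one (2 * s : ℝ)) := by
  -- The clamped reparametrisation runs through `F` at double speed on `[0, 1/2]` and then stays at
  -- `F 1`.
  set u : I → I := fun s => Set.projIcc 0 1 zero_le_one (2 * s : ℝ) with hu
  have huc : Continuous u := continuous_projIcc.comp (by fun_prop)
  have hle : ∀ s : I, (s : ℝ) ≤ 1 / 2 → γ.trans (Path.segment ζ w) s = γ (u s) := by
    intro s hs
    rw [Path.trans_apply, dif_pos hs]
    simp only [hu]
    rw [Set.projIcc_of_mem]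
  have hge : ∀ s : I, 1 / 2 ≤ (s : ℝ) → u s = 1 := fun s hs =>
    Set.projIcc_of_right_le _ (by linarith)
  intro s
  constructor
  · by_cases hs : (s : ℝ) ≤ 1 / 2
    · rw [hle s hs]; exact (hF (u s)).1
    · change HolAt (F (u s)) _
      rw [hge s (not_le.1 hs).le, Path.trans_apply, dif_neg hs]
      exact hw _
  · rcases lt_or_ge (s : ℝ) (1 / 2) with hs | hs
    · filter_upwards [huc.continuousAt.eventually (hF (u s)).2,
        continuous_subtype_val.continuousAt.eventually (eventually_lt_nhds hs)] with s' h1 h2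
      rw [hle s' h2.le]; exact h1
    · filter_upwards [huc.continuousAt.eventually (hF (u s)).2] with s' h1
      by_cases h2 : (s' : ℝ) ≤ 1 / 2
      · rw [hle s' h2]; exact h1
      · change F (u s') =ᶠ[_] F (u s)
        rw [hge s' (not_le.1 h2).le, hge s hs]

/-- The value at a class is that of the final germ of a continuation along a representative. By
monodromy neither choice matters, and appending a short segment keeps the same final germ, so near a
point off the fibre over `0` the function read in the coordinate `π` is that germ. -/
theorem ContAlong.extendsToR {φ : ℂ → ℂ} (hφ : ContAlong φ) : ExtendsToR φ := by
  choose F hF0 hF using fun (ζ : ℂ) (γ : AdmPath ζ) => hφ γ.1 γ.1.continuous γ.1.source γ.2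
  set Φ : RSurface → ℂ := fun c => F c.1 c.2.out 1 c.1 with hΦ
  have hmk : ∀ {ζ : ℂ} (γ : AdmPath ζ) (G : I → ℂ → ℂ), IsCont γ.1 G → G 0 =ᶠ[𝓝 0] φ →
      Φ (RSurface.mk γ) = G 1 ζ := by
    intro ζ γ G hG hG0
    have h : AdmHomotopic (Quotient.mk (admSetoid ζ) γ).out γ :=
      Quotient.exact (s := admSetoid ζ) (Quotient.out_eq _)
    exact (IsCont.end_eq_of_admHomotopic hφ h (hF ζ _) (hF0 ζ _) hG hG0).eq_of_nhds
  have horigin : ∀ c : RSurface, c.1 = 0 → ∀ᶠ w in 𝓝 (0 : ℂ), Φ (c.move w) = φ w := by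
    intro c hc
    obtain ⟨r, hr, h⟩ := Metric.eventually_nhds_iff_ball.1 hφ.analyticAt.eventually_analyticAt
    filter_upwards [eventually_norm_lt_two_pi, ball_mem_nhds 0 hr] with w h1 h2
    rw [RSurface.move_of_eq_zero hc (admissible_segment h1)]
    exact hmk _ (fun _ => φ) (isCont_const fun s => holAt_iff_analyticAt.2
      (h _ (segment_mem_ball (mem_ball_self hr) h2 s))) EventuallyEq.rfl
  refine ⟨Φ, ?_, horigin _ rfl⟩
  rintro ⟨ζ, q⟩
  induction q using Quotient.inductionOn with
  | h γ =>
    change AnalyticAt ℂ (fun w => Φ ((RSurface.mk γ).move w)) ζ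
    by_cases hζ : ζ = 0
    · subst hζ
      exact hφ.analyticAt.congr ((horigin (RSurface.mk γ) rfl).mono fun w hw => hw.symm)
    · have hl : ζ ∉ lattice := by
        rcases γ.2 with h | h
        · exact absurd (by simpa using h 1) hζ
        · simpa using h 1 one_pos
      have h1 : HolAt (F ζ γ 1) ζ := by simpa using (hF ζ γ 1).1
      obtain ⟨r, hr, h2⟩ := Metric.eventually_nhds_iff_ball.1 h1.eventually
      refine (holAt_iff_analyticAt.1 h1).congr ?_
      filter_upwards [ball_mem_nhds ζ hr, ball_mem_nhds ζ (latDist_pos hl)] with w h3 h4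
      have h5 : ∀ t, Path.segment ζ w t ∉ lattice := fun t =>
        notMem_lattice_of_mem_ball (segment_mem_ball (mem_ball_self (latDist_pos hl)) h4 t)
      rw [RSurface.move_mk γ hζ h5]
      have h6 := (hF ζ γ).trans_segment fun t => h2 _ (segment_mem_ball (mem_ball_self hr) h3 t)
      have h7 := hmk (γ.append hζ h5) _ h6 (by simpa using hF0 ζ γ)
      rw [h7]
      simp [Set.projIcc_of_right_le]

end Surface

end Resurgence

theorem mainTheorem3 (φ ψ : ℂ → ℂ) (hφ : AnalyticAt ℂ φ 0) (hψ : AnalyticAt ℂ ψ 0)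
    (hφR : Resurgence.ExtendsToR φ) (hψR : Resurgence.ExtendsToR ψ) :
    Resurgence.ExtendsToR (Resurgence.convolution φ ψ) :=
  (hφR.contAlong.convolution hψR.contAlong).extendsToR
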